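/- Let $G$ be a finite simple graph and $k\ge 1$ an integer. A local $k$-partition of $G$ is a family $\{c_v\}_{v\in V(G)}$ of maps $c_v:E(v)\to\{1,\dots,k\}$, where $E(v)$ is the set of edges incident with $v$. The graph $G$ is conflict $\{c_v\}$-colorable if there is a map $\varphi:V(G)\to\{1,\dots,k\}$ such that no edge $e=xy$ satisfies both $\varphi(x)=c_x(e)$ and $\varphi(y)=c_y(e)$. In a random local $k$-partition, the pair $(c_x(e),c_y(e))$ is chosen uniformly at random from $\{1,\dots,k\}^2$ for each edge $e=xy$, independently for different edges. The maximum density of $G$ is $\rho(G)=\max |E(H)|/|V(H)|$, the maximum being over all subgraphs $H$ of $G$ with at least one vertex. **Theorem.** For every $\varepsilon\in(0,1/2)$ there is $\delta=\delta(\varepsilon)>0$ such that for every function $f:\mathbb N\to\mathbb R$ with $f(n)=o(1/\log^2 n)$ as $n\to\infty$ there is a positive integer $n_0$ for which the following holds. Let $G$ be a simple graph with $n\ge n_0$ vertices, $m\ge (1-f(n))\,n^2/2$ edges, and maximum density $\rho(G)=m/n$. If $k$ is an integer with $$k\ge(1+\delta)\sqrt{\frac{\rho(G)}{\log\rho(G)}},$$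 then, for a random local $k$-partition $\{c_v\}$ of $G$, the graph $G$ is conflict $\{c_v\}$-colorable with probability at least $1-\varepsilon$. -/

import Mathlib

open Filter Asymptotics MeasureTheory ProbabilityTheory

namespace SimpleGraph

/-- A local `k`-partition of `G`: for every vertex `v` a map `c_v : E(v) → [k]`, where `E(v)` is
the set of edges incident with `v`. -/
abbrev LocalPartition {V : Type*} (G : SimpleGraph V) (k : ℕ) : Type _ :=
  (v : V) → G.incidenceSet v → Fin k

/-- `G` is conflict `{c_v}`-colorable: some `φ : V → [k]` is such that no edge `e = xy` satisfies
both `φ x = c_x(e)` and `φ y = c_y(e)`. -/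
def ConflictColorable {V : Type*} (G : SimpleGraph V) {k : ℕ} (c : G.LocalPartition k) : Prop :=
  ∃ φ : V → Fin k, ∀ (x y : V) (h : G.Adj x y),
    ¬ (φ x = c x ⟨s(x, y), G.mk'_mem_incidenceSet_left_iff.2 h⟩ ∧
       φ y = c y ⟨s(x, y), G.mk'_mem_incidenceSet_right_iff.2 h⟩)

/-- The local `k`-partition whose conflict tuple at each edge `e = {x, y}` is
`(t e x, t e y)`. -/
def LocalPartition.ofTuples {V : Type*} (G : SimpleGraph V) (k : ℕ)
    (t : (e : G.edgeSet) → ({v : V // v ∈ (e : Sym2 V)} → Fin k)) : G.LocalPartition k :=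
  fun v e => t ⟨e.1, e.2.1⟩ ⟨v, e.2.2⟩

open Classical in
/-- The law of a random local `k`-partition of `G`: independently for the edges `e = {x, y}`, the
tuple `(c_x(e), c_y(e))` is uniform on the `k ^ 2` pairs of colors. -/
noncomputable def randomLocalPartition {V : Type*} [Fintype V] (G : SimpleGraph V) (k : ℕ) :
    Measure (G.LocalPartition k) :=
  (Measure.pi fun e : G.edgeSet =>
    (uniformOn Set.univ : Measure ({v : V // v ∈ (e : Sym2 V)} → Fin k))).map
      (LocalPartition.ofTuples G k)

/-- The maximum density `ρ(G)`: the maximum of `|E(H)| / |V(H)|` over all subgraphs `H` of `G`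
with at least one vertex. For a finite nonempty vertex set this supremum is over a finite nonempty
family, so it is a maximum. -/
noncomputable def maxDensity {V : Type*} (G : SimpleGraph V) : ℝ :=
  ⨆ H : {H : G.Subgraph // H.verts.Nonempty},
    (H.1.edgeSet.ncard : ℝ) / (H.1.verts.ncard : ℝ)

end SimpleGraph

/-! Apply the second moment method to the number of valid colorings. With `q = k ^ 2` and `w = 1 /
(q - 1)`, the ratio of second moment to squared first moment is the average over independent uniform
`φ`, `ψ` of a product over edges: `1 + w` where both ends agree, `1 - w ^ 2` elsewhere. If `φ` and
`ψ` agree on `a` vertices, at most `a ^ 2 / 2` edges give the first factor, so the ratio is at most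
the mean of `exp (l * a ^ 2 - w ^ 2 * m)` with `l = (w + w ^ 2) / 2`.

Here `a` is binomial with mean `μ = n / k`, and `l * μ ^ 2 = w ^ 2 * n ^ 2 / 2` exactly. Hence `l *
μ ^ 2 - w ^ 2 * m` is at most `w ^ 2 * n ^ 2 * f / 2`, which is small because `w * n = O(log n)` and
`f = o(1 / log ^ 2 n)` (`mul_sq_sub_sq_mul_le`). The remaining mean of `exp (l * (a ^ 2 - μ ^ 2))`
is close to 1 by exponential moments of `a` (`sum_exp_sq_card_agree_le`, `typical_exponent_le`,
`large_exponent_le`). -/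

/-- Under a finite product of uniform laws, the probability of a set is its proportion. -/
lemma measureReal_pi_uniformOn {ι : Type*} [Fintype ι] {Ω : ι → Type*} [∀ i, Fintype (Ω i)]
    [∀ i, Nonempty (Ω i)] [∀ i, MeasurableSpace (Ω i)] [∀ i, MeasurableSingletonClass (Ω i)]
    {q : ℕ} (hq : ∀ i, Fintype.card (Ω i) = q) (S : Finset (∀ i, Ω i)) :
    (Measure.pi fun i => (uniformOn Set.univ : Measure (Ω i))).real (S : Set (∀ i, Ω i)) =
      (S.card : ℝ) / (q : ℝ) ^ Fintype.card ι := by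
  have hpt : ∀ t : ∀ i, Ω i,
      (Measure.pi fun i => (uniformOn Set.univ : Measure (Ω i))).real {t} =
        1 / (q : ℝ) ^ Fintype.card ι := by
    intro t
    rw [measureReal_def, Measure.pi_singleton, ENNReal.toReal_prod]
    have h : ∀ i, ((uniformOn Set.univ : Measure (Ω i)) {t i}).toReal = 1 / (q : ℝ) := by
      intro i
      rw [uniformOn_univ, Measure.count_singleton, hq i]
      simp
    simp [h]
  rw [← sum_measureReal_singleton]
  simp [hpt, div_eq_mul_inv]

/-! ### Second moment method for pattern avoidance -/

/-- The second moment method for the number of `φ` whose pattern `r φ` is avoided everywhere. -/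
lemma sq_card_mul_le_card_avoiding {ι : Type*} [Fintype ι] [DecidableEq ι] {Ω : ι → Type*}
    [∀ i, Fintype (Ω i)] [∀ i, DecidableEq (Ω i)] {Φ : Type*} [Fintype Φ]
    (r : Φ → ∀ i, Ω i) {q : ℕ} (hq : ∀ i, Fintype.card (Ω i) = q) (hq2 : 2 ≤ q) :
    ((Fintype.card Φ : ℝ) * ((q : ℝ) - 1) ^ Fintype.card ι) ^ 2 ≤
      (Finset.card {t : ∀ i, Ω i | ∃ φ, ∀ i, t i ≠ r φ i} : ℝ) *
        ∑ φ, ∑ ψ, ∏ i, ((q : ℝ) - if r φ i = r ψ i then 1 else 2) := by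
  classical
  set I : Φ → (∀ i, Ω i) → ℝ := fun φ t => if ∀ i, t i ≠ r φ i then 1 else 0 with hI
  set S : Finset (∀ i, Ω i) := {t | ∃ φ, ∀ i, t i ≠ r φ i} with hS
  have hcard : ∀ φ ψ, ∑ t, I φ t * I ψ t =
      ∏ i, ((q : ℝ) - if r φ i = r ψ i then 1 else 2) := by
    intro φ ψ
    have h1 : ∑ t, I φ t * I ψ t =
        ((Fintype.piFinset fun i => ({r φ i, r ψ i} : Finset (Ω i))ᶜ).card : ℝ) := by
      rw [Finset.cast_card, ← Finset.sum_filter_add_sum_filter_not Finset.univ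
        (fun t => t ∈ Fintype.piFinset fun i => ({r φ i, r ψ i} : Finset (Ω i))ᶜ)]
      rw [Finset.sum_eq_zero (s := Finset.univ.filter fun t => ¬ (t ∈
        Fintype.piFinset fun i => ({r φ i, r ψ i} : Finset (Ω i))ᶜ))
        (f := fun t => I φ t * I ψ t) (by
        intro t ht
        simp only [Finset.mem_filter, Finset.mem_univ, true_and, Fintype.mem_piFinset,
          Finset.mem_compl, Finset.mem_insert, Finset.mem_singleton, not_or] at ht
        obtain ⟨i, hi⟩ := not_forall.1 ht
        by_cases h : t i = r φ i
        · have : ¬ ∀ i, t i ≠ r φ i := fun h' => h' i h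
          simp [hI, this]
        · have h2 : t i = r ψ i := by tauto
          have : ¬ ∀ i, t i ≠ r ψ i := fun h' => h' i h2
          simp [hI, this]), add_zero]
      refine Finset.sum_congr (by ext; simp) ?_
      intro t ht
      simp only [Fintype.mem_piFinset, Finset.mem_compl, Finset.mem_insert,
          Finset.mem_singleton, not_or] at ht
      have h1 : ∀ i, t i ≠ r φ i := fun i => (ht i).1
      have h2 : ∀ i, t i ≠ r ψ i := fun i => (ht i).2
      simp only [hI]
      rw [if_pos h1, if_pos h2, one_mul]
    rw [h1, Fintype.card_piFinset, Nat.cast_prod]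
    refine Finset.prod_congr rfl fun i _ => ?_
    rw [Finset.card_compl, hq i, Nat.cast_sub ((Finset.card_le_two).trans hq2)]
    split_ifs with h
    · simp [h]
    · rw [Finset.card_pair h]; norm_num
  have hdiag : ∀ φ, ∑ t, I φ t = ((q : ℝ) - 1) ^ Fintype.card ι := by
    intro φ
    have h := hcard φ φ
    have h2 : ∀ t, I φ t * I φ t = I φ t := by intro t; simp only [hI]; split_ifs <;> simp
    simpa [h2] using h
  have hX : ∑ t ∈ S, ∑ φ, I φ t = (Fintype.card Φ : ℝ) * ((q : ℝ) - 1) ^ Fintype.card ι := by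
    rw [Finset.sum_subset (Finset.subset_univ S), Finset.sum_comm]
    · simp [hdiag]
    · intro t _ ht
      refine Finset.sum_eq_zero fun φ _ => ?_
      have : ¬ ∀ i, t i ≠ r φ i := fun h => ht (by
        simp only [hS, Finset.mem_filter, Finset.mem_univ, true_and]; exact ⟨φ, h⟩)
      simp [hI, this]
  have hX2 : ∑ t ∈ S, (∑ φ, I φ t) ^ 2 ≤
      ∑ φ, ∑ ψ, ∏ i, ((q : ℝ) - if r φ i = r ψ i then 1 else 2) := by
    calc ∑ t ∈ S, (∑ φ, I φ t) ^ 2 ≤ ∑ t, (∑ φ, I φ t) ^ 2 :=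
          Finset.sum_le_sum_of_subset_of_nonneg (Finset.subset_univ S) fun _ _ _ => sq_nonneg _
      _ = ∑ t, ∑ φ, ∑ ψ, I φ t * I ψ t := by
          refine Finset.sum_congr rfl fun t _ => ?_
          rw [sq, Finset.sum_mul_sum]
      _ = _ := by
          rw [Finset.sum_comm]
          refine Finset.sum_congr rfl fun φ _ => ?_
          rw [Finset.sum_comm]
          exact Finset.sum_congr rfl fun ψ _ => hcard φ ψ
  rw [← hX]
  -- Cauchy–Schwarz on `S`, outside which the count vanishes.
  exact (sq_sum_le_card_mul_sum_sq).trans (mul_le_mul_of_nonneg_left hX2 (Nat.cast_nonneg _))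

/-- The second moment method, normalised: `p` is the proportion of good points. -/
lemma sq_card_le_proportion_mul_sum_exp {ι : Type*} [Fintype ι] [DecidableEq ι] {Ω : ι → Type*}
    [∀ i, Fintype (Ω i)] [∀ i, DecidableEq (Ω i)] {Φ : Type*} [Fintype Φ]
    (r : Φ → ∀ i, Ω i) {q : ℕ} (hq : ∀ i, Fintype.card (Ω i) = q) (hq2 : 2 ≤ q)
    {w : ℝ} (hw : w = 1 / ((q : ℝ) - 1)) :
    (Fintype.card Φ : ℝ) ^ 2 ≤
      ((Finset.card {t : ∀ i, Ω i | ∃ φ, ∀ i, t i ≠ r φ i} : ℝ) / (q : ℝ) ^ Fintype.card ι) *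
        ∑ φ, ∑ ψ, Real.exp ((w + w ^ 2) * (Finset.card {i | r φ i = r ψ i} : ℝ)
          - w ^ 2 * Fintype.card ι) := by
  have hq2' : (2 : ℝ) ≤ q := by exact_mod_cast hq2
  have hq1 : 0 < (q : ℝ) - 1 := by linarith
  have hpos : 0 < (((q : ℝ) - 1) ^ Fintype.card ι) ^ 2 := by positivity
  have key : ∀ φ ψ, (q : ℝ) ^ Fintype.card ι *
      ∏ i, ((q : ℝ) - if r φ i = r ψ i then 1 else 2) ≤
      (((q : ℝ) - 1) ^ Fintype.card ι) ^ 2 *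
        Real.exp ((w + w ^ 2) * (Finset.card {i | r φ i = r ψ i} : ℝ)
          - w ^ 2 * Fintype.card ι) := by
    intro φ ψ
    have e1 : (w + w ^ 2) * (Finset.card {i | r φ i = r ψ i} : ℝ) - w ^ 2 * Fintype.card ι =
        ∑ i, if r φ i = r ψ i then w else - w ^ 2 := by
      have : ∀ i, (if r φ i = r ψ i then w else - w ^ 2) =
          (w + w ^ 2) * (if r φ i = r ψ i then 1 else 0) - w ^ 2 := by
        intro i; split_ifs <;> ring
      simp only [this, Finset.sum_sub_distrib, ← Finset.mul_sum, Finset.sum_boole,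
        Finset.sum_const, Finset.card_univ, nsmul_eq_mul]
      ring
    rw [e1, Real.exp_sum, ← Finset.card_univ, ← Finset.prod_const, ← Finset.prod_const,
      ← Finset.prod_mul_distrib, ← Finset.prod_pow, ← Finset.prod_mul_distrib]
    have hqw : (q : ℝ) - 1 ≠ 0 := hq1.ne'
    -- Edge by edge: `q (q - 1) = (q - 1) ^ 2 (1 + w)` and `q (q - 2) = (q - 1) ^ 2 (1 - w ^ 2)`.
    refine Finset.prod_le_prod (fun i _ => ?_) fun i _ => ?_
    · split_ifs <;> exact mul_nonneg (by linarith) (by linarith)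
    · split_ifs
      · have := Real.add_one_le_exp w
        calc (q : ℝ) * (q - 1) = (q - 1) ^ 2 * (w + 1) := by rw [hw]; field_simp; ring
          _ ≤ _ := by gcongr
      · have := Real.add_one_le_exp (-w ^ 2)
        calc (q : ℝ) * (q - 2) = (q - 1) ^ 2 * (-w ^ 2 + 1) := by rw [hw]; field_simp; ring
          _ ≤ _ := by gcongr
  have h1 := sq_card_mul_le_card_avoiding r hq hq2
  rw [mul_pow] at h1
  rw [div_mul_eq_mul_div, le_div_iff₀ (by positivity)]
  refine le_of_mul_le_mul_right ?_ hpos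
  calc (Fintype.card Φ : ℝ) ^ 2 * (q : ℝ) ^ Fintype.card ι * (((q : ℝ) - 1) ^ Fintype.card ι) ^ 2
      = (q : ℝ) ^ Fintype.card ι *
        ((Fintype.card Φ : ℝ) ^ 2 * (((q : ℝ) - 1) ^ Fintype.card ι) ^ 2) := by ring
    _ ≤ (q : ℝ) ^ Fintype.card ι * _ := mul_le_mul_of_nonneg_left h1 (by positivity)
    _ = (Finset.card {t : ∀ i, Ω i | ∃ φ, ∀ i, t i ≠ r φ i} : ℝ) *
        ∑ φ, ∑ ψ, (q : ℝ) ^ Fintype.card ι *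
          ∏ i, ((q : ℝ) - if r φ i = r ψ i then 1 else 2) := by
        simp only [← Finset.mul_sum]; ring
    _ ≤ (Finset.card {t : ∀ i, Ω i | ∃ φ, ∀ i, t i ≠ r φ i} : ℝ) * ∑ φ, ∑ ψ,
        ((((q : ℝ) - 1) ^ Fintype.card ι) ^ 2 *
        Real.exp ((w + w ^ 2) * (Finset.card {i | r φ i = r ψ i} : ℝ)
          - w ^ 2 * Fintype.card ι)) := by
        refine mul_le_mul_of_nonneg_left ?_ (Nat.cast_nonneg _)
        exact Finset.sum_le_sum fun φ _ => Finset.sum_le_sum fun ψ _ => key φ ψ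
    _ = _ := by simp only [← Finset.mul_sum]; ring

/-! ### Exponential moments of the agreement count -/

/-- The moment generating function of the number of agreements of two random colorings. -/
lemma sum_exp_card_agree_le (V : Type*) [Fintype V] [DecidableEq V] {k : ℕ} (hk : 0 < k) (t : ℝ) :
    ∑ φ : V → Fin k, ∑ ψ : V → Fin k, Real.exp (t * (Finset.card {v | φ v = ψ v} : ℝ)) ≤
      ((k : ℝ) ^ Fintype.card V) ^ 2 *
        Real.exp ((Fintype.card V : ℝ) / k * (Real.exp t - 1)) := by
  have hk' : (0 : ℝ) < k := by exact_mod_cast hk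
  have h1 : ∀ φ ψ : V → Fin k, Real.exp (t * (Finset.card {v | φ v = ψ v} : ℝ)) =
      ∏ v, (if φ v = ψ v then Real.exp t else 1) := by
    intro φ ψ
    rw [Finset.prod_ite, Finset.prod_const, Finset.prod_const_one, mul_one, mul_comm,
      Real.exp_nat_mul]
  have h2 : ∀ φ : V → Fin k, ∑ ψ : V → Fin k, ∏ v, (if φ v = ψ v then Real.exp t else 1) =
      (Real.exp t + (k - 1)) ^ Fintype.card V := by
    intro φ
    rw [← Fintype.prod_sum (fun v c => if φ v = c then Real.exp t else 1)]
    have : ∀ v, ∑ c, (if φ v = c then Real.exp t else 1) = Real.exp t + (k - 1) := by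
      intro v
      have : ∀ c, (if φ v = c then Real.exp t else 1) =
          (if φ v = c then Real.exp t - 1 else 0) + 1 := by intro c; split_ifs <;> ring
      simp only [this, Finset.sum_add_distrib]
      simp
      ring
    simp [this]
  simp only [h1, h2, Finset.sum_const, Finset.card_univ, Fintype.card_pi, nsmul_eq_mul]
  simp only [Fintype.card_fin, Finset.prod_const, Finset.card_univ, Nat.cast_pow]
  rw [sq, mul_assoc]
  gcongr
  rw [div_mul_eq_mul_div, mul_div_assoc, Real.exp_nat_mul, ← mul_pow]
  have h3 : 0 < Real.exp t := Real.exp_pos t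
  have h4 : (1 : ℝ) ≤ k := by exact_mod_cast hk
  refine pow_le_pow_left₀ (by linarith) ?_ _
  have := Real.add_one_le_exp ((Real.exp t - 1) / k)
  calc Real.exp t + (k - 1) = k * ((Real.exp t - 1) / k + 1) := by field_simp; ring
    _ ≤ _ := by gcongr

/-- Linearizes the square in the exponent so that binomial moment generating functions apply. Above
the cutoff `B`, use `a ^ 2 ≤ n * a` and `a - B ≥ 0`. Below it, when the exponent exceeds `η`, it is
at most `y = l * (B + μ) * (a - μ)`; then `y ≥ η` gives `y ≤ L * y - (L - 1) * η`, and a large `L`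
makes this term negligible on average. -/
lemma exp_sq_sub_sq_le {l μ n a B L η : ℝ} (hl : 0 ≤ l) (ha : 0 ≤ a) (han : a ≤ n)
    (hη : 0 ≤ η) (hL : 1 ≤ L) :
    Real.exp (l * (a ^ 2 - μ ^ 2)) ≤ Real.exp η +
      Real.exp (L * (l * (B + μ)) * (a - μ) - (L - 1) * η) +
      Real.exp (-B + (l * n + 1) * a) := by
  have p1 := Real.exp_pos η
  have p2 := Real.exp_pos (L * (l * (B + μ)) * (a - μ) - (L - 1) * η)
  have p3 := Real.exp_pos (-B + (l * n + 1) * a)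
  have hlm : 0 ≤ l * μ ^ 2 := by positivity
  rcases lt_or_ge B a with h | h
  · have : l * (a ^ 2 - μ ^ 2) ≤ -B + (l * n + 1) * a := by
      nlinarith [mul_nonneg (mul_nonneg hl ha) (sub_nonneg.2 han)]
    linarith [Real.exp_le_exp.2 this]
  rcases le_or_gt (l * (a ^ 2 - μ ^ 2)) η with h' | h'
  · linarith [Real.exp_le_exp.2 h']
  have haμ : μ < a := by
    by_contra! hc
    nlinarith [mul_nonneg hl (sub_nonneg.2 (pow_le_pow_left₀ ha hc 2))]
  have hy : l * (a ^ 2 - μ ^ 2) ≤ l * (B + μ) * (a - μ) := by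
    nlinarith [mul_nonneg (mul_nonneg hl (sub_nonneg.2 haμ.le)) (sub_nonneg.2 h)]
  have : l * (a ^ 2 - μ ^ 2) ≤ L * (l * (B + μ)) * (a - μ) - (L - 1) * η := by
    nlinarith [mul_nonneg (sub_nonneg.2 hL) (h'.le.trans hy |> sub_nonneg.2)]
  linarith [Real.exp_le_exp.2 this]

/-- Averaging `exp_sq_sub_sq_le` over pairs of colorings. -/
lemma sum_exp_sq_card_agree_le (V : Type*) [Fintype V] [DecidableEq V] {k : ℕ} (hk : 0 < k)
    {l μ B L η : ℝ} (hμ : μ = (Fintype.card V : ℝ) / k) (hl : 0 ≤ l) (hη : 0 ≤ η) (hL : 1 ≤ L) :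
    ∑ φ : V → Fin k, ∑ ψ : V → Fin k,
        Real.exp (l * ((Finset.card {v | φ v = ψ v} : ℝ) ^ 2 - μ ^ 2)) ≤
      ((k : ℝ) ^ Fintype.card V) ^ 2 * (Real.exp η +
        Real.exp (μ * (Real.exp (L * (l * (B + μ))) - 1 - L * (l * (B + μ))) - (L - 1) * η) +
        Real.exp (-B + μ * (Real.exp (l * Fintype.card V + 1) - 1))) := by
  set s := L * (l * (B + μ)) with hs
  set n : ℝ := (Fintype.card V : ℝ) with hn
  calc _ ≤ ∑ φ : V → Fin k, ∑ ψ : V → Fin k, (Real.exp η +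
        Real.exp (- s * μ - (L - 1) * η) * Real.exp (s * (Finset.card {v | φ v = ψ v} : ℝ)) +
        Real.exp (-B) * Real.exp ((l * n + 1) * (Finset.card {v | φ v = ψ v} : ℝ))) := by
        refine Finset.sum_le_sum fun φ _ => Finset.sum_le_sum fun ψ _ => ?_
        have h := exp_sq_sub_sq_le (μ := μ) (B := B) (n := n) hl
          (Nat.cast_nonneg (Finset.card {v | φ v = ψ v}))
          (by rw [hn]; exact_mod_cast Finset.card_le_univ _) hη hL
        refine h.trans (le_of_eq ?_)
        rw [← Real.exp_add, ← Real.exp_add]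
        congr 3
        rw [← hs]; ring
    _ = ((k : ℝ) ^ Fintype.card V) ^ 2 * Real.exp η +
        Real.exp (- s * μ - (L - 1) * η) *
          (∑ φ : V → Fin k, ∑ ψ : V → Fin k,
            Real.exp (s * (Finset.card {v | φ v = ψ v} : ℝ))) +
        Real.exp (-B) * (∑ φ : V → Fin k, ∑ ψ : V → Fin k,
            Real.exp ((l * n + 1) * (Finset.card {v | φ v = ψ v} : ℝ))) := by
        simp only [Finset.sum_add_distrib, ← Finset.mul_sum]
        congr 2
        simp
        ring
    _ ≤ ((k : ℝ) ^ Fintype.card V) ^ 2 * Real.exp η +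
        Real.exp (- s * μ - (L - 1) * η) * (((k : ℝ) ^ Fintype.card V) ^ 2 *
          Real.exp (μ * (Real.exp s - 1))) +
        Real.exp (-B) * (((k : ℝ) ^ Fintype.card V) ^ 2 *
          Real.exp (μ * (Real.exp (l * n + 1) - 1))) := by
        rw [hμ]
        gcongr
        · exact sum_exp_card_agree_le V hk s
        · exact sum_exp_card_agree_le V hk _
    _ = _ := by
        have e1 : μ * (Real.exp s - 1 - s) - (L - 1) * η =
          (- s * μ - (L - 1) * η) + μ * (Real.exp s - 1) := by ring
        rw [e1, Real.exp_add (- s * μ - (L - 1) * η), Real.exp_add (-B)]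
        generalize Real.exp (- s * μ - (L - 1) * η) = a
        generalize Real.exp (μ * (Real.exp s - 1)) = b
        generalize Real.exp (μ * (Real.exp (l * n + 1) - 1)) = c
        ring

/-! ### From conflict coloring to pattern avoidance -/

namespace SimpleGraph

/-- A set of `a` vertices spans at most `a ^ 2 / 2` edges. -/
lemma two_mul_card_edges_inside_le {V : Type*} [DecidableEq V] (G : SimpleGraph V)
    [Fintype G.edgeSet] (A : Finset V) (E : Finset G.edgeSet)
    (hE : ∀ e ∈ E, ∀ v ∈ (e : Sym2 V), v ∈ A) : 2 * E.card ≤ A.card ^ 2 := by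
  have h : E.card ≤ A.card.choose 2 := by
    rw [← Sym2.card_image_offDiag]
    refine Finset.card_le_card_of_injOn (fun e => (e : Sym2 V)) ?_ Subtype.val_injective.injOn
    rintro ⟨e, he⟩ heE
    have hA := hE _ heE
    induction e using Sym2.ind with
    | _ x y =>
      simp only [Finset.coe_image, Set.mem_image, Finset.mem_coe, Finset.mem_offDiag]
      refine ⟨(x, y), ⟨hA x (by simp), hA y (by simp), ?_⟩, rfl⟩
      exact G.ne_of_adj he
  have h2 := Nat.choose_two_right A.card
  have h3 : A.card * (A.card - 1) / 2 * 2 ≤ A.card * (A.card - 1) := Nat.div_mul_le_self _ _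
  have h4 : A.card * (A.card - 1) ≤ A.card * A.card := Nat.mul_le_mul_left _ (Nat.sub_le _ _)
  rw [sq]
  omega

/-- Edges are not loops, so each has two distinct ends. -/
lemma card_edge_tuples {V : Type*} (G : SimpleGraph V) (k : ℕ) (e : G.edgeSet)
    [Fintype ({v : V // v ∈ (e : Sym2 V)} → Fin k)] :
    Fintype.card ({v : V // v ∈ (e : Sym2 V)} → Fin k) = k ^ 2 := by
  classical
  obtain ⟨e, he⟩ := e
  rw [← Nat.card_eq_fintype_card]
  induction e using Sym2.ind with
  | _ x y =>
    have hxy : x ≠ y := G.ne_of_adj he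
    have hset : {v | v ∈ s(x, y)} = ({x, y} : Set V) := by
      ext v; simp [Sym2.mem_iff]
    have h2 : Nat.card {v // v ∈ s(x, y)} = 2 := by
      change Set.ncard {v | v ∈ s(x, y)} = 2
      rw [hset, Set.ncard_pair hxy]
    have : Finite {v // v ∈ s(x, y)} := Nat.finite_of_card_ne_zero (by omega)
    rw [Nat.card_fun, h2, Nat.card_eq_fintype_card, Fintype.card_fin]

/-- The colors that a vertex coloring gives to the ends of an edge. -/
def edgeColors {V : Type*} (G : SimpleGraph V) {k : ℕ} (φ : V → Fin k) (e : G.edgeSet) :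
    {v : V // v ∈ (e : Sym2 V)} → Fin k := fun v => φ v

lemma conflictColorable_ofTuples_iff {V : Type*} (G : SimpleGraph V) (k : ℕ)
    (t : (e : G.edgeSet) → ({v : V // v ∈ (e : Sym2 V)} → Fin k)) :
    G.ConflictColorable (LocalPartition.ofTuples G k t) ↔
      ∃ φ : V → Fin k, ∀ e : G.edgeSet, t e ≠ G.edgeColors φ e := by
  refine exists_congr fun φ => ⟨?_, ?_⟩
  · rintro h ⟨e, he⟩ hte
    induction e using Sym2.ind with
    | _ x y =>
      refine h x y he ⟨?_, ?_⟩ <;> simp [LocalPartition.ofTuples, hte, edgeColors]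
  · rintro h x y hxy ⟨h1, h2⟩
    refine h ⟨s(x, y), hxy⟩ ?_
    ext1 ⟨v, hv⟩
    rcases Sym2.mem_iff.1 hv with rfl | rfl
    · exact h1.symm
    · exact h2.symm

open Classical in
lemma randomLocalPartition_real_conflictColorable {V : Type*} [Fintype V] (G : SimpleGraph V)
    {k : ℕ} (hk : 0 < k) :
    (G.randomLocalPartition k).real {c | G.ConflictColorable c} =
      (Finset.card {t : (e : G.edgeSet) → ({v : V // v ∈ (e : Sym2 V)} → Fin k) |
        ∃ φ : V → Fin k, ∀ e : G.edgeSet, t e ≠ G.edgeColors φ e} : ℝ) /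
        ((k ^ 2 : ℕ) : ℝ) ^ Fintype.card G.edgeSet := by
  have : Nonempty (Fin k) := ⟨⟨0, hk⟩⟩
  rw [← measureReal_pi_uniformOn (fun e => G.card_edge_tuples k e), randomLocalPartition,
    map_measureReal_apply (measurable_of_countable _) (Set.toFinite _).measurableSet]
  congr 1
  ext t
  simp [conflictColorable_ofTuples_iff]

/-- The second moment bound for the probability of conflict colorability. -/
lemma one_le_real_conflictColorable_mul {V : Type*} [Fintype V] (G : SimpleGraph V)
    {k : ℕ} (hk : 2 ≤ k) {w l μ B L η : ℝ} (hw : w = 1 / ((k : ℝ) ^ 2 - 1))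
    (hl : l = (w + w ^ 2) / 2) (hμ : μ = (Fintype.card V : ℝ) / k) (hη : 0 ≤ η) (hL : 1 ≤ L) :
    1 ≤ (G.randomLocalPartition k).real {c | G.ConflictColorable c} *
      (Real.exp (l * μ ^ 2 - w ^ 2 * G.edgeSet.ncard) * (Real.exp η +
        Real.exp (μ * (Real.exp (L * (l * (B + μ))) - 1 - L * (l * (B + μ))) - (L - 1) * η) +
        Real.exp (-B + μ * (Real.exp (l * Fintype.card V + 1) - 1)))) := by
  classical
  have hk0 : 0 < k := by omega
  have hk2 : (2 : ℝ) ≤ k := by exact_mod_cast hk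
  have hw0 : 0 ≤ w := by rw [hw]; apply one_div_nonneg.2; nlinarith
  have hl0 : 0 ≤ l := by rw [hl]; positivity
  have h := sq_card_le_proportion_mul_sum_exp
    (G.edgeColors (k := k)) (q := k ^ 2)
    (fun e => G.card_edge_tuples k e)
    (by nlinarith) (w := w) (by rw [hw]; push_cast; rfl)
  have hP := randomLocalPartition_real_conflictColorable G hk0
  have hcard : (Fintype.card (V → Fin k) : ℝ) = (k : ℝ) ^ Fintype.card V := by simp
  rw [hcard] at h
  have hE : G.edgeSet.ncard = Fintype.card G.edgeSet := by
    rw [Set.ncard_eq_toFinset_card', Set.toFinset_card]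
  set P := (G.randomLocalPartition k).real {c | G.ConflictColorable c} with hPdef
  have hP0 : 0 ≤ P := measureReal_nonneg
  have hKpos : 0 < ((k : ℝ) ^ Fintype.card V) ^ 2 := by positivity
  refine le_of_mul_le_mul_left ?_ hKpos
  rw [mul_one]
  refine h.trans ?_
  rw [show ∀ (K a b c : ℝ), K * (a * (b * c)) = a * (b * (K * c)) by intros; ring]
  refine mul_le_mul hP.symm.le ?_ (by positivity) hP0
  refine le_trans ?_ (mul_le_mul_of_nonneg_left
    (sum_exp_sq_card_agree_le V hk0 hμ hl0 hη hL) (Real.exp_pos _).le)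
  rw [Finset.mul_sum]
  refine Finset.sum_le_sum fun φ _ => ?_
  rw [Finset.mul_sum]
  refine Finset.sum_le_sum fun ψ _ => ?_
  rw [← Real.exp_add]
  refine Real.exp_le_exp.2 ?_
  rw [hE]
  -- An edge whose two end colors coincide under `φ` and `ψ` lies inside their agreement set.
  have h2 := G.two_mul_card_edges_inside_le ({v | φ v = ψ v} : Finset V)
    {e | G.edgeColors φ e = G.edgeColors ψ e} (by
      intro e he v hv
      simp only [Finset.mem_filter, Finset.mem_univ, true_and] at he ⊢
      exact congrFun he ⟨v, hv⟩)
  have h3 : (2 : ℝ) * (Finset.card {e | G.edgeColors φ e = G.edgeColors ψ e} : ℝ) ≤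
      (Finset.card {v | φ v = ψ v} : ℝ) ^ 2 := by
    exact_mod_cast h2
  have h4 := mul_le_mul_of_nonneg_left h3 hl0
  rw [hl] at h4 ⊢
  linarith

end SimpleGraph

/-! ### Asymptotic estimates -/

/-- Size estimates for `k` colors and `x ^ 50` vertices. -/
lemma color_size_bounds {x k w : ℝ} (hx1 : 1 ≤ x) (hk1 : 2 ≤ k)
    (hk : 25 * x ^ 50 ≤ Real.log (x ^ 50) * k ^ 2) (hw : w = 1 / (k ^ 2 - 1)) :
    x ^ 24 ≤ k ∧ 0 < w ∧ w ≤ 1 ∧ w * k ^ 2 ≤ 2 ∧ w + w ^ 2 = w ^ 2 * k ^ 2 ∧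
      w * x ^ 50 ≤ 4 * Real.log x := by
  have hx0 : 0 < x := by linarith
  have hlog : Real.log (x ^ 50) = 50 * Real.log x := by rw [Real.log_pow]; norm_num
  have hlogx : 2 * Real.log x ≤ x ^ 2 := by
    have := Real.log_le_sub_one_of_pos (show 0 < x ^ 2 by positivity)
    rw [Real.log_pow] at this
    push_cast at this
    linarith
  have hlx0 : 0 ≤ Real.log x := Real.log_nonneg hx1
  have hk2 : 4 ≤ k ^ 2 := by nlinarith
  have hk0 : 0 < k := by linarith
  have hk24 : x ^ 24 ≤ k := by
    have h1 : 25 * x ^ 50 ≤ 25 * x ^ 2 * k ^ 2 := by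
      refine hk.trans ?_
      rw [hlog]
      have := sq_nonneg k
      nlinarith
    have h2 : (x ^ 24) ^ 2 ≤ k ^ 2 := by
      refine le_of_mul_le_mul_left ?_ (show 0 < 25 * x ^ 2 by positivity)
      calc 25 * x ^ 2 * (x ^ 24) ^ 2 = 25 * x ^ 50 := by ring
        _ ≤ _ := h1
    exact le_of_sq_le_sq h2 hk0.le
  have hkp : 0 < k ^ 2 - 1 := by linarith
  have hw0 : 0 < w := by rw [hw]; positivity
  have hw1 : w ≤ 1 := by rw [hw, div_le_one hkp]; linarith
  have hwk : w * k ^ 2 ≤ 2 := by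
    rw [hw, div_mul_eq_mul_div, div_le_iff₀ hkp]; linarith
  -- This identity makes the main terms of order `w ^ 2 * n ^ 2` cancel.
  have hwk' : (w + w ^ 2) = w ^ 2 * k ^ 2 := by
    rw [hw]; field_simp; ring
  have hwn : w * x ^ 50 ≤ 4 * Real.log x := by
    have h1 : w * (25 * x ^ 50) ≤ w * (Real.log (x ^ 50) * k ^ 2) := by gcongr
    rw [hlog] at h1
    nlinarith
  exact ⟨hk24, hw0, hw1, hwk, hwk', hwn⟩

/-- The deterministic factor of the second moment bound. -/
lemma mul_sq_sub_sq_mul_le {ε x k w l μ m f : ℝ} (hx1 : 1 ≤ x)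
    (hk1 : 2 ≤ k) (hk : 25 * x ^ 50 ≤ Real.log (x ^ 50) * k ^ 2)
    (hw : w = 1 / (k ^ 2 - 1)) (hl : l = (w + w ^ 2) / 2) (hμ : μ = x ^ 50 / k)
    (hf : (Real.log (x ^ 50)) ^ 2 * |f| ≤ ε / 2) (hm : (1 - f) * ((x ^ 50) ^ 2 / 2) ≤ m) :
    l * μ ^ 2 - w ^ 2 * m ≤ ε / 4 := by
  obtain ⟨hk24, hw0, hw1, hwk, hwk', hwn⟩ := color_size_bounds hx1 hk1 hk hw
  have hx0 : 0 < x := by linarith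
  have hk0 : 0 < k := by linarith
  have hlx0 : 0 ≤ Real.log x := Real.log_nonneg hx1
  have hlog : Real.log (x ^ 50) = 50 * Real.log x := by rw [Real.log_pow]; norm_num
  have h1 : l * μ ^ 2 = w ^ 2 * (x ^ 50) ^ 2 / 2 := by
    rw [hl, hwk', hμ]; field_simp
  have h2 : w ^ 2 * ((1 - f) * ((x ^ 50) ^ 2 / 2)) ≤ w ^ 2 * m := by gcongr
  have h3 : (w * x ^ 50) ^ 2 ≤ (Real.log (x ^ 50)) ^ 2 := by
    rw [hlog]
    exact pow_le_pow_left₀ (by positivity) (by linarith) 2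
  have h4 : (w * x ^ 50) ^ 2 * f ≤ ε / 2 :=
    calc (w * x ^ 50) ^ 2 * f ≤ (w * x ^ 50) ^ 2 * |f| := by gcongr; exact le_abs_self f
      _ ≤ (Real.log (x ^ 50)) ^ 2 * |f| := by gcongr
      _ ≤ _ := hf
  rw [h1]
  nlinarith

/-- The contribution of typical agreement sets. -/
lemma typical_exponent_le {ε η L x k w l μ : ℝ} (hx1 : 1 ≤ x) (hL : 1 ≤ L)
    (hLη : 1 - (L - 1) * η ≤ Real.log (ε / 8)) (hxL : 64 * L ^ 2 ≤ x ^ 8)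
    (hk1 : 2 ≤ k) (hk : 25 * x ^ 50 ≤ Real.log (x ^ 50) * k ^ 2)
    (hw : w = 1 / (k ^ 2 - 1)) (hl : l = (w + w ^ 2) / 2) (hμ : μ = x ^ 50 / k) :
    μ * (Real.exp (L * (l * (x ^ 5 * (μ + 1) + μ))) - 1 - L * (l * (x ^ 5 * (μ + 1) + μ))) -
      (L - 1) * η ≤ Real.log (ε / 8) := by
  obtain ⟨hk24, hw0, hw1, hwk, hwk', hwn⟩ := color_size_bounds hx1 hk1 hk hw
  have hx0 : 0 < x := by linarith
  have hk0 : 0 < k := by linarith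
  have hl0 : 0 ≤ l := by rw [hl]; positivity
  have hlw : l ≤ w := by rw [hl]; nlinarith
  have hμ0 : 0 ≤ μ := by rw [hμ]; positivity
  have hμx : μ ≤ x ^ 26 := by
    rw [hμ, div_le_iff₀ hk0]
    calc x ^ 50 = x ^ 26 * x ^ 24 := by ring
      _ ≤ _ := by gcongr
  set θ := l * (x ^ 5 * (μ + 1) + μ) with hθ
  have hθ0 : 0 ≤ θ := by positivity
  have hθx : θ * x ^ 17 ≤ 8 := by
    have h1 : x ^ 5 * (μ + 1) + μ ≤ 4 * x ^ 31 := by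
      have h2 : 1 ≤ x ^ 26 := one_le_pow₀ hx1
      have h3 : x ^ 26 ≤ x ^ 31 := pow_le_pow_right₀ hx1 (by norm_num)
      have h4 : x ^ 5 * (μ + 1) ≤ x ^ 5 * (2 * x ^ 26) := by gcongr; linarith
      have h5 : x ^ 5 * (2 * x ^ 26) = 2 * x ^ 31 := by ring
      linarith
    have h6 : w * x ^ 48 ≤ 2 := by
      refine le_trans ?_ hwk
      calc w * x ^ 48 = w * (x ^ 24) ^ 2 := by ring
        _ ≤ _ := by gcongr
    calc θ * x ^ 17 ≤ (w * (4 * x ^ 31)) * x ^ 17 := by rw [hθ]; gcongr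
      _ = 4 * (w * x ^ 48) := by ring
      _ ≤ 8 := by linarith
  have hLx : 8 * L ≤ x ^ 4 := by
    refine le_of_sq_le_sq (by nlinarith) (by positivity)
  have hLθ : L * θ * x ^ 13 ≤ 1 := by
    refine le_of_mul_le_mul_right ?_ (show 0 < x ^ 4 by positivity)
    calc L * θ * x ^ 13 * x ^ 4 = L * (θ * x ^ 17) := by ring
      _ ≤ L * 8 := by gcongr
      _ ≤ _ := by linarith
  have hLθ0 : 0 ≤ L * θ := by positivity
  have hLθ1 : L * θ ≤ 1 := by
    refine le_trans ?_ hLθ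
    exact le_mul_of_one_le_right hLθ0 (one_le_pow₀ hx1)
  -- The linear term is gone, so only `μ * (L * θ) ^ 2` matters: `μ ≤ x ^ 26` against `L * θ ≤ x ^
  -- (-13)`.
  have h1 : Real.exp (L * θ) - 1 - L * θ ≤ (L * θ) ^ 2 := by
    have := Real.abs_exp_sub_one_sub_id_le (x := L * θ) (by rwa [abs_of_nonneg hLθ0])
    exact (le_abs_self _).trans this
  have h2 : μ * (Real.exp (L * θ) - 1 - L * θ) ≤ 1 :=
    calc μ * (Real.exp (L * θ) - 1 - L * θ) ≤ x ^ 26 * (L * θ) ^ 2 :=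
          mul_le_mul hμx h1 (by linarith [Real.add_one_le_exp (L * θ)]) (by positivity)
      _ = (L * θ * x ^ 13) ^ 2 := by ring
      _ ≤ 1 := pow_le_one₀ (by positivity) hLθ
  linarith

/-- The contribution of large agreement sets. -/
lemma large_exponent_le {ε x k w l μ : ℝ} (hx1 : 1 ≤ x) (hx : Real.exp 1 ≤ x)
    (hxε : Real.log (8 / ε) ≤ x ^ 5)
    (hk1 : 2 ≤ k) (hk : 25 * x ^ 50 ≤ Real.log (x ^ 50) * k ^ 2)
    (hw : w = 1 / (k ^ 2 - 1)) (hl : l = (w + w ^ 2) / 2) (hμ : μ = x ^ 50 / k) :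
    -(x ^ 5 * (μ + 1)) + μ * (Real.exp (l * x ^ 50 + 1) - 1) ≤ Real.log (ε / 8) := by
  obtain ⟨hk24, hw0, hw1, hwk, hwk', hwn⟩ := color_size_bounds hx1 hk1 hk hw
  have hx0 : 0 < x := by linarith
  have hk0 : 0 < k := by linarith
  have hl0 : 0 ≤ l := by rw [hl]; positivity
  have hlw : l ≤ w := by rw [hl]; nlinarith
  have hμ0 : 0 ≤ μ := by rw [hμ]; positivity
  -- This fixes the factor `x ^ 5` in the cutoff `x ^ 5 * (μ + 1)`; its `+ 1` leaves a margin `-x ^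
  -- 5` however small `μ` is.
  have h1 : Real.exp (l * x ^ 50 + 1) ≤ x ^ 5 := by
    have h2 : l * x ^ 50 ≤ 4 * Real.log x := le_trans (by gcongr) hwn
    calc Real.exp (l * x ^ 50 + 1) = Real.exp (l * x ^ 50) * Real.exp 1 := Real.exp_add _ _
      _ ≤ Real.exp (4 * Real.log x) * x := by gcongr
      _ = x ^ 5 := by
        rw [show (4 : ℝ) * Real.log x = Real.log (x ^ 4) by rw [Real.log_pow]; norm_num,
          Real.exp_log (by positivity)]
        ring
  have h3 : Real.log (ε / 8) = - Real.log (8 / ε) := by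
    rw [← Real.log_inv, inv_div]
  rw [h3]
  nlinarith [mul_le_mul_of_nonneg_left h1 hμ0]

/-- The size estimates for the second moment bound with `n = x ^ 50`. -/
lemma second_moment_ratio_le {ε η L x k w l μ m f : ℝ} (hx1 : 1 ≤ x) (hx : Real.exp 1 ≤ x)
    (hη : η = ε / 4) (hL : 1 ≤ L) (hLη : 1 - (L - 1) * η ≤ Real.log (ε / 8)) (hε : 0 < ε)
    (hxL : 64 * L ^ 2 ≤ x ^ 8) (hxε : Real.log (8 / ε) ≤ x ^ 5)
    (hk1 : 2 ≤ k) (hk : 25 * x ^ 50 ≤ Real.log (x ^ 50) * k ^ 2)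
    (hw : w = 1 / (k ^ 2 - 1)) (hl : l = (w + w ^ 2) / 2) (hμ : μ = x ^ 50 / k)
    (hf : (Real.log (x ^ 50)) ^ 2 * |f| ≤ ε / 2)
    (hm : (1 - f) * ((x ^ 50) ^ 2 / 2) ≤ m) :
    Real.exp (l * μ ^ 2 - w ^ 2 * m) * (Real.exp η +
      Real.exp (μ * (Real.exp (L * (l * (x ^ 5 * (μ + 1) + μ))) - 1 -
        L * (l * (x ^ 5 * (μ + 1) + μ))) - (L - 1) * η) +
      Real.exp (-(x ^ 5 * (μ + 1)) + μ * (Real.exp (l * x ^ 50 + 1) - 1))) ≤ Real.exp ε := by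
  have hA := mul_sq_sub_sq_mul_le hx1 hk1 hk hw hl hμ hf hm
  have hC := typical_exponent_le hx1 hL hLη hxL hk1 hk hw hl hμ
  have hD := large_exponent_le hx1 hx hxε hk1 hk hw hl hμ
  have e1 := (Real.le_log_iff_exp_le (by positivity)).1 hC
  have e2 := (Real.le_log_iff_exp_le (by positivity)).1 hD
  have e3 : 1 ≤ Real.exp (ε / 4) := Real.one_le_exp (by positivity)
  have e4 := Real.add_one_le_exp (ε / 4)
  calc _ ≤ Real.exp (ε / 4) * (Real.exp η + ε / 8 + ε / 8) := by gcongr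
    -- With `t = ε / 4`: `t ≤ exp t - 1 ≤ exp t * (exp t - 1)`.
    _ ≤ Real.exp (ε / 4) * (Real.exp (ε / 4) * Real.exp (ε / 4)) := by
        rw [hη]; gcongr; nlinarith
    _ = Real.exp (3 * ε / 4) := by rw [← Real.exp_add, ← Real.exp_add]; ring_nf
    _ ≤ _ := Real.exp_le_exp.2 (by linarith)

/-- A lower bound for the number of colors in terms of the number of vertices. -/
lemma le_log_mul_sq_of_sqrt_le {n ρ k : ℝ} (hn : 8 < n) (h1 : n / 4 ≤ ρ) (h2 : ρ ≤ n)
    (hk : 10 * Real.sqrt (ρ / Real.log ρ) ≤ k) : 25 * n ≤ Real.log n * k ^ 2 := by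
  have hρ : 1 < ρ := by linarith
  have hlρ := Real.log_pos hρ
  have hll : Real.log ρ ≤ Real.log n := Real.log_le_log (by linarith) h2
  have h0 : 0 ≤ ρ / Real.log ρ := by positivity
  have hln : 0 ≤ Real.log n := hlρ.le.trans hll
  have h3 : 100 * (ρ / Real.log ρ) ≤ k ^ 2 := by
    have := pow_le_pow_left₀ (by positivity) hk 2
    rw [mul_pow, Real.sq_sqrt h0] at this
    linarith
  calc 25 * n ≤ 100 * ρ := by linarith
    _ = Real.log ρ * (100 * (ρ / Real.log ρ)) := by field_simp
    _ ≤ Real.log n * k ^ 2 := by gcongr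

/-! ### The theorem -/

theorem mainTheorem2 (ε : ℝ) (hε : ε ∈ Set.Ioo (0 : ℝ) (1 / 2)) :
    ∃ δ : ℝ, 0 < δ ∧
      ∀ f : ℕ → ℝ, f =o[atTop] (fun n : ℕ => 1 / (Real.log (n : ℝ)) ^ 2) →
        ∃ n₀ : ℕ, 0 < n₀ ∧
          ∀ (V : Type*) [Fintype V] (G : SimpleGraph V) (n m : ℕ),
            Fintype.card V = n → G.edgeSet.ncard = m → n₀ ≤ n →
            (1 - f n) * ((n : ℝ) ^ 2 / 2) ≤ (m : ℝ) →
            G.maxDensity = (m : ℝ) / (n : ℝ) →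
            ∀ k : ℕ,
              (1 + δ) * Real.sqrt (G.maxDensity / Real.log G.maxDensity) ≤ (k : ℝ) →
              1 - ε ≤ (G.randomLocalPartition k).real {c | G.ConflictColorable c} := by
  obtain ⟨hε0, hε1⟩ := hε
  -- `δ = 9` serves every `ε`: `k ^ 2 ≥ 100 * ρ / log ρ` and `n / 4 ≤ ρ ≤ n` give `k ^ 2 ≥ 25 * n /
  -- log n`.
  refine ⟨9, by norm_num, fun f hf => ?_⟩
  obtain ⟨L, hL1, hL⟩ : ∃ L : ℝ, 1 ≤ L ∧ 1 - (L - 1) * (ε / 4) ≤ Real.log (ε / 8) := by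
    -- Equality in the second condition; its leading 1 absorbs the quadratic remainder in
    -- `typical_exponent_le`.
    refine ⟨1 + (1 - Real.log (ε / 8)) / (ε / 4), ?_, ?_⟩
    · have : Real.log (ε / 8) ≤ 0 := Real.log_nonpos (by linarith) (by linarith)
      have : 0 ≤ (1 - Real.log (ε / 8)) / (ε / 4) := div_nonneg (by linarith) (by linarith)
      linarith
    · field_simp
      linarith
  -- The root `x = n ^ (1 / 50)` turns all later size comparisons into integer powers of `x`.
  have hxt : Tendsto (fun n : ℕ => (n : ℝ) ^ ((1 : ℝ) / 50)) atTop atTop :=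
    (tendsto_rpow_atTop (by norm_num)).comp tendsto_natCast_atTop_atTop
  have hev : ∀ᶠ n : ℕ in atTop, |f n| ≤ ε / 2 * (1 / (Real.log (n : ℝ)) ^ 2) := by
    filter_upwards [hf.def (show 0 < ε / 2 by linarith)] with n h
    rwa [Real.norm_eq_abs, Real.norm_of_nonneg (by positivity)] at h
  have hall := hev.and ((hxt.eventually_ge_atTop (Real.exp 1)).and
    ((((tendsto_pow_atTop (by norm_num : (8 : ℕ) ≠ 0)).comp hxt).eventually_ge_atTop
      (64 * L ^ 2)).and
    ((((tendsto_pow_atTop (by norm_num : (5 : ℕ) ≠ 0)).comp hxt).eventually_ge_atTop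
      (Real.log (8 / ε))).and (eventually_ge_atTop 9))))
  obtain ⟨n₀, hn₀⟩ := eventually_atTop.1 hall
  refine ⟨n₀ + 1, by omega, ?_⟩
  intro V _ G n m hV hm hn hmf hρ k hk
  obtain ⟨hfn, hxe, hxL, hxε, hn9⟩ := hn₀ n (by omega)
  simp only [Function.comp] at hxL hxε
  have hn9' : (9 : ℝ) ≤ n := by exact_mod_cast hn9
  have hn0 : (0 : ℝ) < n := by linarith
  obtain ⟨x, hxdef⟩ : ∃ x : ℝ, x = (n : ℝ) ^ ((1 : ℝ) / 50) := ⟨_, rfl⟩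
  rw [← hxdef] at hxe hxL hxε
  have hxn : x ^ 50 = n := by
    rw [hxdef, ← Real.rpow_natCast, ← Real.rpow_mul hn0.le]; norm_num
  have hx1 : 1 ≤ x := (Real.one_le_exp zero_le_one).trans hxe
  have hlog1 : 1 ≤ Real.log n := by
    rw [← hxn, Real.le_log_iff_exp_le (by positivity)]
    exact hxe.trans (le_self_pow₀ hx1 (by norm_num))
  have hlogf : (Real.log n) ^ 2 * |f n| ≤ ε / 2 := by
    have h : 0 < (Real.log n) ^ 2 := by positivity
    calc (Real.log n) ^ 2 * |f n| ≤ (Real.log n) ^ 2 * (ε / 2 * (1 / (Real.log n) ^ 2)) := by gcongr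
      _ = ε / 2 := by field_simp
  have hf1 : f n ≤ 1 / 2 := by
    have : 1 ≤ (Real.log n) ^ 2 := one_le_pow₀ hlog1
    have h2 : |f n| ≤ (Real.log n) ^ 2 * |f n| := le_mul_of_one_le_left (abs_nonneg _) this
    linarith [le_abs_self (f n)]
  have hρ1 : (n : ℝ) / 4 ≤ m / n := by
    rw [le_div_iff₀ hn0]
    nlinarith [sq_nonneg (n : ℝ)]
  have hρ2 : (m : ℝ) / n ≤ n := by
    classical
    rw [div_le_iff₀ hn0]
    have h := G.two_mul_card_edges_inside_le Finset.univ Finset.univ (by simp)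
    rw [Finset.card_univ, Finset.card_univ, ← Set.toFinset_card, ← Set.ncard_eq_toFinset_card', hm,
      hV] at h
    have : m ≤ n * n := by nlinarith
    exact_mod_cast this
  rw [hρ] at hk
  have hk25 := le_log_mul_sq_of_sqrt_le (by linarith) hρ1 hρ2 (by norm_num at hk ⊢; exact hk)
  -- For `k ≤ 1` the bound would read `25 * n ≤ log n`.
  have hk2 : 2 ≤ k := by
    by_contra! hlt
    have h1 : (k : ℝ) ≤ 1 := by exact_mod_cast Nat.lt_succ_iff.1 hlt
    have h2 : (k : ℝ) ^ 2 ≤ 1 := pow_le_one₀ (Nat.cast_nonneg k) h1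
    have h3 := Real.log_le_sub_one_of_pos hn0
    nlinarith
  have hk2' : (2 : ℝ) ≤ k := by exact_mod_cast hk2
  have hR := second_moment_ratio_le hx1 hxe rfl hL1 hL hε0 hxL hxε hk2' (by rwa [hxn]) rfl rfl rfl
    (f := f n) (m := m) (by rwa [hxn]) (by rwa [hxn])
  rw [hxn] at hR
  have hS := G.one_le_real_conflictColorable_mul hk2 (L := L) (η := ε / 4)
    (B := x ^ 5 * ((n : ℝ) / k + 1)) rfl rfl rfl (by linarith) hL1
  rw [hV, hm] at hS
  set P := (G.randomLocalPartition k).real {c | G.ConflictColorable c}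
  have hP0 : 0 ≤ P := measureReal_nonneg
  have h1 : 1 ≤ P * Real.exp ε := hS.trans (mul_le_mul_of_nonneg_left hR hP0)
  have h2 : Real.exp (-ε) ≤ P := by
    rw [Real.exp_neg, inv_le_iff_one_le_mul₀ (Real.exp_pos _)]
    exact h1
  linarith [Real.add_one_le_exp (-ε)]
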